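/- Let $q$, $n$, $d$ be positive integers with $q\ge 2$ and $d\le n$. Let $A_q(n,d)$ denote the maximum number of words in a code of length $n$ and minimum Hamming distance at least $d$ over an alphabet with $q$ letters ($q$ need not be a prime power). For an integer $m\ge 0$ let $$V_q(n,m)=\sum_{i=0}^{m}\binom{n}{i}(q-1)^i$$ be the volume of a $q$-ary Hamming sphere of radius $m$, and let $$e_q(n,m)=\frac16\sum_{w=1}^{m}\sum_{i=1}^{m}\sum_{j=0}^{a}\sum_{k=b}^{a-j}\frac{n!\,(q-2)^k\,(q-1)^{w+i-c}}{j!\,k!\,(w-c)!\,(i-c)!\,(n+c-w-i)!}\;-\;\frac{V_q(n,m)}{6},$$ where $a=\min\{w,i\}$, $c=j+k$, $b$ is the smallest nonnegative integer that is at least $(w+i)-j-\min\{m+j,n\}$, and $0^0=1$. Suppose that $e_q(n,d-1)>0$, so that its logarithm is defined (this fails only if $d=1$ or $q=d=2$, where $e_q(n,d-1)=-\tfrac16$). Then $$A_q(n,d)\;\ge\;\frac{q^n}{V_q(n,d-1)}\cdot\frac{\log_2 V_q(n,d-1)-\log_2\sqrt{e_q(n,d-1)}}{10}.$$ -/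

import Mathlib

open Finset

/-- `IsCode q n d C`: the set `C` of words of length `n` over the `q`-letter alphabet `Fin q` is a
code of minimum distance at least `d`, that is, any two distinct words of `C` differ in at least
`d` positions. -/
def IsCode (q n d : ℕ) (C : Finset (Fin n → Fin q)) : Prop :=
  ∀ u ∈ C, ∀ v ∈ C, u ≠ v → d ≤ hammingDist u v

open Classical in
/-- `A_q(n, d)`: the maximum number of words in a `q`-ary code of length `n` and minimum
distance (at least) `d`. -/
noncomputable def maxCodeSize (q n d : ℕ) : ℕ :=
  ((univ : Finset (Finset (Fin n → Fin q))).filter (IsCode q n d)).sup Finset.card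

/-- `V_q(n, d) = ∑_{i=0}^{d} C(n, i) (q - 1)^i`, the volume of a `q`-ary Hamming sphere of
radius `d`. -/
def sphereVolume (q n d : ℕ) : ℝ :=
  ∑ i ∈ Icc 0 d, (n.choose i : ℝ) * ((q : ℝ) - 1) ^ i

/-- The lower limit `b` of the innermost sum: the smallest nonnegative integer that is at least
`(w + i) - j - min (d + j) n` (an integer that may be negative). -/
def lowerLimit (n d w i j : ℕ) : ℕ :=
  (((w : ℤ) + i) - j - min ((d : ℤ) + j) n).toNat

/-- The summand of the quadruple sum, with `c = j + k`. In the range of summation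
`c ≤ min w i` and `w + i ≤ n + c`, so that none of the natural-number subtractions truncates. -/
noncomputable def edgeTerm (q n w i j k : ℕ) : ℝ :=
  ((n.factorial : ℝ) * ((q : ℝ) - 2) ^ k * ((q : ℝ) - 1) ^ (w + i - (j + k))) /
    ((j.factorial : ℝ) * (k.factorial : ℝ) * ((w - (j + k)).factorial : ℝ) *
      ((i - (j + k)).factorial : ℝ) * ((n + (j + k) - w - i).factorial : ℝ))

/-- The quantity `e_q(n, d)`, with `a = min w i` and `b = lowerLimit n d w i j`. -/
noncomputable def edgeQuantity (q n d : ℕ) : ℝ :=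
  1 / 6 * (∑ w ∈ Icc 1 d, ∑ i ∈ Icc 1 d, ∑ j ∈ Icc 0 (min w i),
    ∑ k ∈ Icc (lowerLimit n d w i j) (min w i - j), edgeTerm q n w i j k)
  - sphereVolume q n d / 6

/-!
For a graph in which all degrees are at most `D` and every neighbourhood spans few edges, draw an
independent set `J` from the hard-core model at a suitable small fugacity `x`. Given `J` away from
the neighbourhood of a vertex `v`, let `H` be the set of neighbours of `v` that are still free and
`Z` the partition function of the hard-core model on `H`. Then `v` is occupied with probability
about `x / Z`, whereas the expected number of occupied neighbours of `v` is at least about `log Z`,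
because `H` spans few edges. Whatever `Z` is, a weighted sum of the two quantities is large, and
averaging it over `v` gives a large expected independent set. When the neighbourhoods are too dense
for this, the greedy bound `card V / (D + 1)` is already good enough.

Codes are the independent sets of the Gilbert graph, in which words at distance at most `d - 1` are
adjacent. It is vertex transitive, of degree `sphereVolume - 1`, and counting the pairs of words in
a ball by the configurations of their pairs of letters shows that each neighbourhood contains
exactly `6 * edgeQuantity + 1` ordered adjacent pairs.
-/

section HardCoreModel

variable {V : Type*} (G : SimpleGraph V) [DecidableRel G.Adj]

/-- The vertices of `H` with no neighbour in `J`, which are those that may be added to an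
independent set `J`. -/
def freeVertices (J H : Finset V) : Finset V :=
  {u ∈ H | ∀ w ∈ J, ¬ G.Adj u w}

variable {G} {x : ℝ} {H J K S T : Finset V} {u v : V}

theorem mem_freeVertices : u ∈ freeVertices G J H ↔ u ∈ H ∧ ∀ w ∈ J, ¬ G.Adj u w :=
  mem_filter

theorem freeVertices_subset : freeVertices G J H ⊆ H :=
  filter_subset _ _

theorem card_interedges_eq_sum (S T : Finset V) :
    #(G.interedges S T) = ∑ u ∈ S, #{v ∈ T | G.Adj u v} := by
  simp only [SimpleGraph.interedges_def, card_filter, sum_product]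

variable [DecidableEq V]

variable (G) in
/-- The independent sets of `G` contained in `H`: the configurations of the hard-core model on
`H`. -/
def indepSubsets (H : Finset V) : Finset (Finset V) :=
  {K ∈ H.powerset | G.IsIndepSet (K : Set V)}

variable (G) in
/-- The partition function of the hard-core model on `H` at fugacity `x`. -/
def partitionFunction (x : ℝ) (H : Finset V) : ℝ :=
  ∑ K ∈ indepSubsets G H, x ^ #K

variable (G) in
/-- The unnormalised expected number of occupied vertices in the hard-core model on `H` at fugacity
`x`; dividing it by `partitionFunction G x H` gives the expectation. -/
def occupancy (x : ℝ) (H : Finset V) : ℝ :=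
  ∑ K ∈ indepSubsets G H, (#K : ℝ) * x ^ #K

theorem mem_indepSubsets :
    K ∈ indepSubsets G H ↔ K ⊆ H ∧ ∀ u ∈ K, ∀ v ∈ K, ¬ G.Adj u v := by
  simp only [indepSubsets, mem_filter, mem_powerset, SimpleGraph.isIndepSet_iff]
  exact and_congr_right fun _ =>
    ⟨fun h u hu v hv huv => h hu hv huv.ne huv, fun h u hu v hv _ => h u hu v hv⟩

theorem indepSubsets_mono (hST : S ⊆ T) : indepSubsets G S ⊆ indepSubsets G T :=
  filter_subset_filter _ (powerset_mono.2 hST)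

theorem empty_mem_indepSubsets : ∅ ∈ indepSubsets G H :=
  mem_indepSubsets.2 (by simp)

theorem indepSubsets_singleton : indepSubsets G {v} = {∅, {v}} := by
  ext K
  simp only [mem_indepSubsets, subset_singleton_iff, mem_insert, mem_singleton,
    and_iff_left_iff_imp]
  rintro (rfl | rfl) <;> simp

theorem union_mem_indepSubsets (hJ : J ∈ indepSubsets G S)
    (hK : K ∈ indepSubsets G (freeVertices G J T)) : J ∪ K ∈ indepSubsets G (S ∪ T) := by
  rw [mem_indepSubsets] at *
  have hfree : ∀ u ∈ K, ∀ w ∈ J, ¬ G.Adj u w := fun u hu => (mem_freeVertices.1 (hK.1 hu)).2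
  refine ⟨union_subset_union hJ.1 (hK.1.trans freeVertices_subset), fun a ha b hb => ?_⟩
  rcases mem_union.1 ha with ha | ha <;> rcases mem_union.1 hb with hb | hb
  · exact hJ.2 a ha b hb
  · exact fun h => hfree b hb a ha h.symm
  · exact hfree a ha b hb
  · exact hK.2 a ha b hb

theorem inter_mem_indepSubsets (hK : K ∈ indepSubsets G H) : K ∩ S ∈ indepSubsets G S :=
  mem_indepSubsets.2 ⟨inter_subset_right, fun a ha b hb =>
    (mem_indepSubsets.1 hK).2 a (mem_inter.1 ha).1 b (mem_inter.1 hb).1⟩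

theorem inter_mem_indepSubsets_freeVertices (hK : K ∈ indepSubsets G H) :
    K ∩ T ∈ indepSubsets G (freeVertices G (K ∩ S) T) := by
  have hindep := (mem_indepSubsets.1 hK).2
  refine mem_indepSubsets.2 ⟨fun a ha => mem_freeVertices.2 ⟨(mem_inter.1 ha).2, fun w hw => ?_⟩,
    (mem_indepSubsets.1 (inter_mem_indepSubsets hK)).2⟩
  exact hindep a (mem_inter.1 ha).1 w (mem_inter.1 hw).1

theorem sum_indepSubsets_union {M : Type*} [AddCommMonoid M] (hST : Disjoint S T)
    (f : Finset V → M) :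
    ∑ I ∈ indepSubsets G (S ∪ T), f I =
      ∑ J ∈ indepSubsets G S, ∑ K ∈ indepSubsets G (freeVertices G J T), f (J ∪ K) := by
  rw [sum_sigma']
  refine sum_nbij' (fun I => ⟨I ∩ S, I ∩ T⟩) (fun p => p.1 ∪ p.2)
    (fun I hI => mem_sigma.2 ⟨inter_mem_indepSubsets hI, inter_mem_indepSubsets_freeVertices hI⟩)
    (fun p hp => union_mem_indepSubsets (mem_sigma.1 hp).1 (mem_sigma.1 hp).2) ?_ ?_ ?_
  · intro I hI
    rw [← inter_union_distrib_left, inter_eq_left.2 (mem_indepSubsets.1 hI).1]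
  · rintro ⟨J, K⟩ hp
    obtain ⟨hJ, hK⟩ := mem_sigma.1 hp
    have hJS : J ⊆ S := (mem_indepSubsets.1 hJ).1
    have hKT : K ⊆ T := (mem_indepSubsets.1 hK).1.trans freeVertices_subset
    simp only [union_inter_distrib_right, inter_eq_left.2 hJS, inter_eq_left.2 hKT,
      disjoint_iff_inter_eq_empty.1 (hST.mono_left hJS),
      disjoint_iff_inter_eq_empty.1 (hST.symm.mono_left hKT), union_empty, empty_union]
  · intro I hI
    rw [← inter_union_distrib_left, inter_eq_left.2 (mem_indepSubsets.1 hI).1]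

theorem sum_indepSubsets_insert {M : Type*} [AddCommMonoid M] (hv : v ∉ H) (f : Finset V → M) :
    ∑ I ∈ indepSubsets G (insert v H), f I =
      ∑ K ∈ indepSubsets G H, f K +
        ∑ K ∈ indepSubsets G (freeVertices G {v} H), f (insert v K) := by
  have hfree : freeVertices G ∅ H = H := by simp [freeVertices]
  rw [insert_eq, sum_indepSubsets_union (disjoint_singleton_left.2 hv), indepSubsets_singleton,
    sum_pair (singleton_ne_empty v).symm, hfree]
  simp only [empty_union, insert_eq]

theorem partitionFunction_pos (hx : 0 ≤ x) : 0 < partitionFunction G x H :=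
  sum_pos' (fun _ _ => by positivity) ⟨∅, empty_mem_indepSubsets, by simp⟩

theorem occupancy_nonneg (hx : 0 ≤ x) : 0 ≤ occupancy G x H :=
  sum_nonneg fun _ _ => by positivity

theorem partitionFunction_mono (hx : 0 ≤ x) (hST : S ⊆ T) :
    partitionFunction G x S ≤ partitionFunction G x T :=
  sum_le_sum_of_subset_of_nonneg (indepSubsets_mono hST) fun _ _ _ => by positivity

theorem partitionFunction_le_exp (hx : 0 ≤ x) :
    partitionFunction G x H ≤ Real.exp (x * #H) :=
  calc partitionFunction G x H
      ≤ ∑ K ∈ H.powerset, x ^ #K :=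
        sum_le_sum_of_subset_of_nonneg (filter_subset _ _) fun _ _ _ => by positivity
    _ = (x + 1) ^ #H := by simpa using sum_pow_mul_eq_add_pow x 1 H
    _ ≤ Real.exp x ^ #H := by gcongr; exact Real.add_one_le_exp x
    _ = Real.exp (x * #H) := by rw [← Real.exp_nat_mul, mul_comm]

theorem pow_card_union (hJH : Disjoint J H) (hK : K ∈ indepSubsets G H) :
    x ^ #(J ∪ K) = x ^ #J * x ^ #K := by
  rw [card_union_of_disjoint (hJH.mono_right (mem_indepSubsets.1 hK).1), pow_add]

theorem sum_pow_card_union (hJH : Disjoint J H) :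
    ∑ K ∈ indepSubsets G H, x ^ #(J ∪ K) = x ^ #J * partitionFunction G x H := by
  rw [partitionFunction, mul_sum]
  exact sum_congr rfl fun K hK => pow_card_union hJH hK

theorem sum_pow_card_insert (hv : v ∉ H) :
    ∑ K ∈ indepSubsets G H, x ^ #(insert v K) = x * partitionFunction G x H := by
  simpa using sum_pow_card_union (G := G) (x := x) (disjoint_singleton_left.2 hv)

theorem partitionFunction_union_le (hx : 0 ≤ x) (hST : Disjoint S T) :
    partitionFunction G x (S ∪ T) ≤ partitionFunction G x S * partitionFunction G x T := by
  rw [partitionFunction, sum_indepSubsets_union hST, partitionFunction, sum_mul]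
  refine sum_le_sum fun J hJ => ?_
  rw [sum_pow_card_union (hST.mono (mem_indepSubsets.1 hJ).1 freeVertices_subset)]
  gcongr
  exact partitionFunction_mono hx freeVertices_subset

theorem partitionFunction_insert (hv : v ∉ H) :
    partitionFunction G x (insert v H) =
      partitionFunction G x H + x * partitionFunction G x (freeVertices G {v} H) := by
  rw [← sum_pow_card_insert fun h => hv (freeVertices_subset h)]
  exact sum_indepSubsets_insert hv _

theorem occupancy_eq_sum (x : ℝ) (H : Finset V) :
    occupancy G x H =
      ∑ u ∈ H, x * partitionFunction G x (freeVertices G {u} (H.erase u)) := by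
  calc occupancy G x H
      = ∑ K ∈ indepSubsets G H, ∑ u ∈ H, if u ∈ K then x ^ #K else 0 := by
        refine sum_congr rfl fun K hK => ?_
        rw [← sum_filter, sum_const, nsmul_eq_mul, filter_mem_eq_inter,
          inter_eq_right.2 (mem_indepSubsets.1 hK).1]
    _ = ∑ u ∈ H, ∑ K ∈ indepSubsets G H, if u ∈ K then x ^ #K else 0 := sum_comm
    _ = _ := by
        refine sum_congr rfl fun u hu => ?_
        have hu_free : u ∉ freeVertices G {u} (H.erase u) := fun h =>
          notMem_erase u H (freeVertices_subset h)
        conv_lhs => rw [← insert_erase hu]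
        rw [sum_indepSubsets_insert (notMem_erase u H), sum_eq_zero fun K hK => if_neg fun h =>
          notMem_erase u H ((mem_indepSubsets.1 hK).1 h), zero_add, ← sum_pow_card_insert hu_free]
        exact sum_congr rfl fun K _ => if_pos (mem_insert_self u K)

theorem sub_mul_partitionFunction_le (hx : 0 ≤ x) (hu : u ∈ H) :
    (1 - x * #{v ∈ H | G.Adj u v}) * partitionFunction G x H ≤
      (1 + x) * partitionFunction G x (freeVertices G {u} (H.erase u)) := by
  set N := {v ∈ H | G.Adj u v}
  set F := freeVertices G {u} (H.erase u)
  have hdisj : Disjoint F N := by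
    refine disjoint_left.2 fun w hwF hwN => ?_
    exact (mem_freeVertices.1 hwF).2 u (mem_singleton_self u) (mem_filter.1 hwN).2.symm
  have herase : H.erase u ⊆ F ∪ N := by
    intro w hw
    by_cases huw : G.Adj u w
    · exact mem_union_right _ (mem_filter.2 ⟨mem_of_mem_erase hw, huw⟩)
    · refine mem_union_left _ (mem_freeVertices.2 ⟨hw, fun a ha h => huw ?_⟩)
      rwa [mem_singleton.1 ha, G.adj_comm] at h
  have hZF : 0 ≤ partitionFunction G x F := (partitionFunction_pos hx).le
  have hZ : partitionFunction G x H =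
      partitionFunction G x (H.erase u) + x * partitionFunction G x F := by
    rw [← partitionFunction_insert (notMem_erase u H), insert_erase hu]
  have herase_le : partitionFunction G x (H.erase u) ≤
      Real.exp (x * #N) * partitionFunction G x F :=
    calc _ ≤ partitionFunction G x (F ∪ N) := partitionFunction_mono hx herase
      _ ≤ partitionFunction G x F * partitionFunction G x N := partitionFunction_union_le hx hdisj
      _ ≤ _ := by rw [mul_comm]; gcongr; exact partitionFunction_le_exp hx
  have hmul : (1 - x * #N) * partitionFunction G x (H.erase u) ≤ partitionFunction G x F :=
    calc _ ≤ Real.exp (-(x * #N)) * partitionFunction G x (H.erase u) := by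
          gcongr
          · exact (partitionFunction_pos hx).le
          · exact Real.one_sub_le_exp_neg _
      _ ≤ Real.exp (-(x * #N)) * (Real.exp (x * #N) * partitionFunction G x F) := by gcongr
      _ = partitionFunction G x F := by rw [← mul_assoc, ← Real.exp_add]; simp
  have hloss : 0 ≤ x * #N * (x * partitionFunction G x F) := by positivity
  rw [hZ]
  linarith

theorem mul_partitionFunction_le_occupancy (hx : 0 ≤ x) :
    x * (#H - x * #(G.interedges H H)) * partitionFunction G x H ≤
      (1 + x) * occupancy G x H := by
  calc x * (#H - x * #(G.interedges H H)) * partitionFunction G x H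
      = ∑ u ∈ H, x * ((1 - x * #{v ∈ H | G.Adj u v}) * partitionFunction G x H) := by
        rw [card_interedges_eq_sum, ← mul_sum, ← sum_mul, sum_sub_distrib, ← mul_sum]
        simp only [sum_const, nsmul_eq_mul, mul_one, Nat.cast_sum]
        ring
    _ ≤ ∑ u ∈ H, x * ((1 + x) * partitionFunction G x (freeVertices G {u} (H.erase u))) :=
        sum_le_sum fun u hu => mul_le_mul_of_nonneg_left (sub_mul_partitionFunction_le hx hu) hx
    _ = (1 + x) * occupancy G x H := by
        rw [occupancy_eq_sum, mul_sum]
        exact sum_congr rfl fun u _ => by ring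

variable [Fintype V]

theorem sum_indepSubsets_univ {M : Type*} [AddCommMonoid M] (v : V) (f : Finset V → M) :
    ∑ I ∈ indepSubsets G univ, f I =
      ∑ J ∈ indepSubsets G (insert v (G.neighborFinset v))ᶜ,
        (f (insert v J) +
          ∑ K ∈ indepSubsets G (freeVertices G J (G.neighborFinset v)), f (J ∪ K)) := by
  set N := G.neighborFinset v with hN
  set S := (insert v N)ᶜ with hS
  have hdisj : Disjoint S N := (disjoint_insert_right.1 disjoint_compl_left).2
  have hv : v ∉ S ∪ N := by simp [hS, hN]
  have huniv : univ = insert v (S ∪ N) := by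
    ext u
    simp only [hS, mem_univ, mem_insert, mem_union, mem_compl]
    tauto
  have hfree : freeVertices G {v} (S ∪ N) = S := by
    ext u
    simp only [mem_freeVertices, mem_union, hS, hN, mem_compl, mem_insert,
      SimpleGraph.mem_neighborFinset, forall_eq, mem_singleton, G.adj_comm u v]
    tauto
  rw [huniv, sum_indepSubsets_insert hv, hfree, sum_indepSubsets_union hdisj, add_comm,
    sum_add_distrib]

theorem partitionFunction_univ (x : ℝ) (v : V) :
    partitionFunction G x univ =
      ∑ J ∈ indepSubsets G (insert v (G.neighborFinset v))ᶜ,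
        x ^ #J * (x + partitionFunction G x (freeVertices G J (G.neighborFinset v))) := by
  set N := G.neighborFinset v
  rw [partitionFunction, sum_indepSubsets_univ v]
  refine sum_congr rfl fun J hJ => ?_
  have hJN : Disjoint J (insert v N) :=
    (subset_compl_iff_disjoint_right (t := insert v N)).1 (mem_indepSubsets.1 hJ).1
  rw [disjoint_insert_right] at hJN
  rw [sum_pow_card_union (hJN.2.mono_right freeVertices_subset), card_insert_of_notMem hJN.1]
  ring

theorem sum_local_count_mul_pow_card (x D : ℝ) (v : V) :
    ∑ I ∈ indepSubsets G univ,
        (D * (if v ∈ I then 1 else 0) + #(I ∩ G.neighborFinset v)) * x ^ #I =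
      ∑ J ∈ indepSubsets G (insert v (G.neighborFinset v))ᶜ,
        x ^ #J * (D * x + occupancy G x (freeVertices G J (G.neighborFinset v))) := by
  set N := G.neighborFinset v with hN
  have hvN : v ∉ N := by simp [hN]
  rw [sum_indepSubsets_univ v]
  refine sum_congr rfl fun J hJ => ?_
  have hJN : Disjoint J (insert v N) :=
    (subset_compl_iff_disjoint_right (t := insert v N)).1 (mem_indepSubsets.1 hJ).1
  obtain ⟨hvJ, hJN⟩ := disjoint_insert_right.1 hJN
  have hJN_inter : J ∩ N = ∅ := disjoint_iff_inter_eq_empty.1 hJN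
  have hoccupancy : ∑ K ∈ indepSubsets G (freeVertices G J N),
      (D * (if v ∈ J ∪ K then 1 else 0) + #((J ∪ K) ∩ N)) * x ^ #(J ∪ K) =
        x ^ #J * occupancy G x (freeVertices G J N) := by
    rw [occupancy, mul_sum]
    refine sum_congr rfl fun K hK => ?_
    have hKN : K ⊆ N := (mem_indepSubsets.1 hK).1.trans freeVertices_subset
    have hvK : v ∉ J ∪ K := fun hv => (mem_union.1 hv).elim hvJ fun hv => hvN (hKN hv)
    rw [pow_card_union (hJN.mono_right freeVertices_subset) hK, if_neg hvK,
      union_inter_distrib_right, hJN_inter, empty_union, inter_eq_left.2 hKN]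
    ring
  rw [hoccupancy, if_pos (mem_insert_self v J), insert_inter_of_notMem hvN, hJN_inter,
    card_insert_of_notMem hvJ, card_empty, Nat.cast_zero]
  ring

variable (G) in
/-- The local occupancy condition on the hard-core model at fugacity `x`. Given the configuration
outside the closed neighbourhood of `v`, the hard-core model on the free neighbours `H` of `v`
has partition function `Z(H)`, so `v` is occupied with probability `x / (x + Z(H))`. Dividing by
`x + Z(H)`, the condition says that `D · 1[v ∈ I] + |I ∩ N(v)|` has conditional expectation at
least `b`. -/
def HasLocalOccupancy (x b D : ℝ) : Prop :=
  ∀ v, ∀ H ⊆ G.neighborFinset v,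
    b * (x + partitionFunction G x H) ≤ D * x + occupancy G x H

theorem HasLocalOccupancy.mul_partitionFunction_le {b D : ℝ} (h : HasLocalOccupancy G x b D)
    (hx : 0 ≤ x) (v : V) :
    b * partitionFunction G x univ ≤
      ∑ I ∈ indepSubsets G univ,
        (D * (if v ∈ I then 1 else 0) + #(I ∩ G.neighborFinset v)) * x ^ #I := by
  rw [partitionFunction_univ x v, sum_local_count_mul_pow_card, mul_sum]
  refine sum_le_sum fun J _ => ?_
  rw [mul_left_comm]
  gcongr
  exact h v _ freeVertices_subset

theorem sum_card_inter_neighborFinset (I : Finset V) :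
    ∑ v, #(I ∩ G.neighborFinset v) = ∑ u ∈ I, G.degree u := by
  have hcard : ∀ v, #(I ∩ G.neighborFinset v) = ∑ u ∈ I, if u ∈ G.neighborFinset v then 1 else 0 :=
    fun v => by rw [← card_filter, filter_mem_eq_inter]
  simp only [hcard]
  rw [sum_comm]
  refine sum_congr rfl fun u _ => ?_
  rw [← card_filter, ← SimpleGraph.card_neighborFinset_eq_degree]
  congr 1
  ext v
  simp [G.adj_comm]

theorem HasLocalOccupancy.mul_card_le {b : ℝ} {D : ℕ} (h : HasLocalOccupancy G x b D) (hx : 0 < x)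
    (hD : ∀ v, G.degree v ≤ D) : b * Fintype.card V ≤ 2 * D * G.indepNum := by
  have hsum := sum_le_sum fun v (_ : v ∈ (univ : Finset V)) => h.mul_partitionFunction_le hx.le v
  rw [sum_const, card_univ, nsmul_eq_mul, sum_comm, partitionFunction, mul_sum, mul_sum] at hsum
  obtain ⟨I, hI, hle⟩ := exists_le_of_sum_le ⟨∅, empty_mem_indepSubsets⟩ hsum
  rw [← sum_mul, ← mul_assoc] at hle
  have hinter : (∑ v, #(I ∩ G.neighborFinset v) : ℝ) ≤ #I * D := by
    rw [← Nat.cast_sum, sum_card_inter_neighborFinset]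
    exact_mod_cast sum_le_card_nsmul I _ D fun u _ => hD u
  have hindep : #I ≤ G.indepNum :=
    SimpleGraph.IsIndepSet.card_le_indepNum (mem_filter.1 hI).2
  calc b * Fintype.card V
      ≤ ∑ v, (D * (if v ∈ I then 1 else 0) + #(I ∩ G.neighborFinset v) : ℝ) := by
        rw [mul_comm]
        exact le_of_mul_le_mul_right hle (pow_pos hx #I)
    _ = D * #I + ∑ v, (#(I ∩ G.neighborFinset v) : ℝ) := by
        rw [sum_add_distrib, ← mul_sum, sum_boole, filter_univ_mem]
    _ ≤ 2 * D * #I := by linarith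
    _ ≤ 2 * D * G.indepNum := by gcongr

/-- In the hard-core model on a neighbourhood `H`, either the partition function is at most `M` and
`h_small` applies, or `x |H| ≥ log M`, so that many vertices of `H` are occupied because `H` spans
few edges. -/
theorem hasLocalOccupancy_of_interedges_le {b D M p : ℝ} (hx : 0 ≤ x) (hb : 0 ≤ b) (hM : 0 < M)
    (hp : ∀ v, (#(G.interedges (G.neighborFinset v) (G.neighborFinset v)) : ℝ) ≤ p)
    (h_small : b * (x + M) ≤ D * x) (h_large : b * (1 + x) ≤ Real.log M - x ^ 2 * p) :
    HasLocalOccupancy G x b D := by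
  intro v H hH
  have hZ : 0 < partitionFunction G x H := partitionFunction_pos hx
  rcases le_total (partitionFunction G x H) M with hZM | hMZ
  · calc b * (x + partitionFunction G x H) ≤ b * (x + M) := by gcongr
      _ ≤ D * x := h_small
      _ ≤ D * x + occupancy G x H := le_add_of_nonneg_right (occupancy_nonneg hx)
  · have hcard : Real.log M ≤ x * #H :=
      (Real.log_le_iff_le_exp hM).2 (hMZ.trans (partitionFunction_le_exp hx))
    have hedges : (#(G.interedges H H) : ℝ) ≤ p :=
      (Nat.cast_le.2 (card_le_card (SimpleGraph.interedges_mono G hH hH))).trans (hp v)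
    have hbZ : b * partitionFunction G x H ≤ occupancy G x H := by
      refine le_of_mul_le_mul_left (a := 1 + x) ?_ (by linarith)
      calc (1 + x) * (b * partitionFunction G x H)
          = b * (1 + x) * partitionFunction G x H := by ring
        _ ≤ (Real.log M - x ^ 2 * p) * partitionFunction G x H := by gcongr
        _ ≤ (x * #H - x ^ 2 * #(G.interedges H H)) * partitionFunction G x H := by gcongr
        _ = x * (#H - x * #(G.interedges H H)) * partitionFunction G x H := by ring
        _ ≤ (1 + x) * occupancy G x H := mul_partitionFunction_le_occupancy hx
    have hbx : b * x ≤ D * x :=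
      (mul_le_mul_of_nonneg_left (le_add_of_nonneg_right hM.le) hb).trans h_small
    linarith

end HardCoreModel

section LocallySparseGraphs

variable {V : Type*} [Fintype V] {G : SimpleGraph V} [DecidableRel G.Adj]

/-- A maximum independent set dominates the graph. -/
theorem card_le_indepNum_mul {D : ℕ} (hD : ∀ v, G.degree v ≤ D) :
    Fintype.card V ≤ G.indepNum * (D + 1) := by
  classical
  obtain ⟨I, hI⟩ := G.maximumIndepSet_exists
  have hdominates : univ ⊆ I.biUnion fun u => insert u (G.neighborFinset u) := by
    intro v _
    by_contra hv
    simp only [mem_biUnion, mem_insert, SimpleGraph.mem_neighborFinset, not_exists, not_and,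
      not_or] at hv
    have hinsert : G.IsIndepSet (insert v I : Finset V) := by
      rw [coe_insert]
      exact hI.isIndepSet.insert fun u hu _ => ⟨fun h => (hv u hu).2 h.symm, (hv u hu).2⟩
    have hvI : v ∈ I := hI.isMaximalIndepSet.2 hinsert (subset_insert v I) (mem_insert_self v I)
    exact (hv v hvI).1 rfl
  rw [← SimpleGraph.maximumIndepSet_card_eq_indepNum I hI, ← card_univ]
  refine (card_le_card hdominates).trans (card_biUnion_le_card_mul _ _ _ fun u _ => ?_)
  exact (card_insert_le _ _).trans (Nat.succ_le_succ (hD u))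

theorem logb_two_le_mul_of_le {r : ℝ} (hr : 32 ≤ r) : Real.logb 2 r ≤ 5 / 32 * r := by
  have hlog2 := Real.log_two_gt_d9
  have hlog32 : Real.log 32 = 5 * Real.log 2 := by
    rw [show (32 : ℝ) = 2 ^ 5 by norm_num, Real.log_pow]
    norm_num
  have hlog : Real.log r ≤ 5 * Real.log 2 + (r / 32 - 1) := by
    have := Real.log_le_sub_one_of_pos (x := r / 32) (by positivity)
    rw [Real.log_div (by positivity) (by norm_num), hlog32] at this
    linarith
  rw [Real.logb, div_le_iff₀ (by linarith)]
  nlinarith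

theorem hasLocalOccupancy_of_locally_sparse [DecidableEq V] {D p r : ℝ} (hp : 1 ≤ p)
    (hedges : ∀ v, #(G.interedges (G.neighborFinset v) (G.neighborFinset v)) ≤ p) (hr : 32 ≤ r)
    (hD : r ^ 2 * √(p / 12) ≤ D + 1) :
    HasLocalOccupancy G (1 / (2 * √p)) (2 / 5 * Real.logb 2 r) D := by
  have hlog2 := Real.log_two_gt_d9
  set x := 1 / (2 * √p) with hx
  have hx0 : 0 < x := by positivity
  have hx_half : x ≤ 1 / 2 :=
    one_div_le_one_div_of_le two_pos (by linarith [Real.one_le_sqrt.2 hp])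
  have hx_sq : x ^ 2 * p = 1 / 4 := by
    rw [hx, div_pow, mul_pow, Real.sq_sqrt (by linarith)]
    field_simp
    norm_num
  have hx_sqrt : 1 / 8 ≤ x * √(p / 12) := by
    have : √p ≤ 4 * √(p / 12) := by
      rw [Real.sqrt_le_left (by positivity), mul_pow, Real.sq_sqrt (by positivity)]
      linarith
    rw [hx, div_mul_eq_mul_div, le_div_iff₀ (by positivity)]
    linarith
  have hlogb : 5 ≤ Real.logb 2 r := by
    rw [Real.le_logb_iff_rpow_le one_lt_two (by linarith)]
    norm_num [hr]
  have hlog : Real.log r = Real.logb 2 r * Real.log 2 := (div_mul_cancel₀ _ (by linarith)).symm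
  refine hasLocalOccupancy_of_interedges_le (M := r) hx0.le (by linarith) (by linarith) hedges ?_ ?_
  · calc 2 / 5 * Real.logb 2 r * (x + r)
        ≤ 2 / 5 * (5 / 32 * r) * (1 / 2 + r) := by gcongr; exact logb_two_le_mul_of_le hr
      _ ≤ r ^ 2 * (1 / 8) - 1 / 2 := by nlinarith
      _ ≤ r ^ 2 * (x * √(p / 12)) - x := by gcongr
      _ = (r ^ 2 * √(p / 12) - 1) * x := by ring
      _ ≤ D * x := by gcongr; linarith
  · calc 2 / 5 * Real.logb 2 r * (1 + x)
        ≤ 2 / 5 * Real.logb 2 r * (1 + 1 / 2) := by gcongr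
      _ ≤ Real.logb 2 r * Real.log 2 - 1 / 4 := by nlinarith
      _ = Real.log r - x ^ 2 * p := by rw [hlog, hx_sq]

theorem card_mul_logb_le_indepNum {D : ℕ} {p : ℝ} (hD : ∀ v, G.degree v ≤ D) (hp : 1 ≤ p)
    (hedges : ∀ v, #(G.interedges (G.neighborFinset v) (G.neighborFinset v)) ≤ p) :
    Fintype.card V / (D + 1) * (Real.logb 2 ((D + 1) / √(p / 12)) / 10) ≤ G.indepNum := by
  classical
  set r := √((D + 1) / √(p / 12)) with hr
  have hr2 : r ^ 2 * √(p / 12) = D + 1 := by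
    rw [hr, Real.sq_sqrt (by positivity), div_mul_cancel₀ _ (by positivity)]
  have hlogb : Real.logb 2 ((D + 1) / √(p / 12)) = 2 * Real.logb 2 r := by
    rw [← hr2, mul_div_cancel_right₀ _ (by positivity), Real.logb_pow, Nat.cast_ofNat]
  rw [hlogb]
  rcases le_or_gt (Real.logb 2 r) 5 with hr5 | hr5
  · have hgreedy : (Fintype.card V : ℝ) / (D + 1) ≤ G.indepNum := by
      rw [div_le_iff₀ (by positivity)]
      exact_mod_cast card_le_indepNum_mul hD
    exact (mul_le_of_le_one_right (by positivity) (by linarith)).trans hgreedy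
  have hr32 : 32 ≤ r := by
    have := (Real.lt_logb_iff_rpow_lt one_lt_two (by positivity)).1 hr5
    norm_num at this
    exact this.le
  have hN := (hasLocalOccupancy_of_locally_sparse hp hedges hr32 hr2.le).mul_card_le
    (by positivity) hD
  rw [div_mul_eq_mul_div, div_le_iff₀ (by positivity)]
  linarith [G.indepNum.cast_nonneg (α := ℝ)]

end LocallySparseGraphs

section FiberCounting

variable {ι α κ : Type*} [Fintype ι] [Fintype κ]

theorem natCast_multinomial_univ (t : κ → ℕ) :
    (Nat.multinomial univ t : ℝ) = (∑ c, t c).factorial / ∏ c, ((t c).factorial : ℝ) := by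
  rw [eq_div_iff (by positivity), mul_comm]
  exact_mod_cast Nat.multinomial_spec univ t

variable [DecidableEq κ]

open MvPolynomial in
theorem coeff_prod_X_eq_ite (t : κ →₀ ℕ) (g : ι → κ) :
    coeff t (∏ i, X (g i) : MvPolynomial κ ℕ) = if ∀ c, #{i | g i = c} = t c then 1 else 0 := by
  have hprod : (∏ i, X (g i) : MvPolynomial κ ℕ) = ∏ c, X c ^ #{i | g i = c} := by
    rw [prod_comp X g]
    exact prod_subset (subset_univ _) fun c _ hc => by simp_all
  simp [hprod, coeff_prod_X_pow, Finsupp.ext_iff, eq_comm]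

open MvPolynomial in
/-- Compare coefficients in `(∑ a, X (f a)) ^ n = ∑ g, ∏ i, X (f (g i))`. -/
theorem card_filter_fiber_card_eq [DecidableEq ι] [Fintype α] (f : α → κ) (t : κ → ℕ)
    (ht : ∑ c, t c = Fintype.card ι) :
    #{g : ι → α | ∀ c, #{i | f (g i) = c} = t c} =
      Nat.multinomial univ t * ∏ c, #{a | f a = c} ^ t c := by
  set s : κ →₀ ℕ := Finsupp.equivFunOnFinite.symm t with hs
  have hsum : ∑ a, (X (f a) : MvPolynomial κ ℕ) = ∑ c, #{a | f a = c} • X c := by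
    simp only [← sum_const, sum_filter, sum_comm (s := (univ : Finset κ)), sum_ite_eq, mem_univ,
      if_true]
  have hcoeff : coeff s ((∑ a, X (f a) : MvPolynomial κ ℕ) ^ Fintype.card ι) =
      #{g : ι → α | ∀ c, #{i | f (g i) = c} = t c} := by
    rw [← card_univ, ← prod_const, prod_univ_sum, Fintype.piFinset_univ, coeff_sum, card_filter]
    exact sum_congr rfl fun g _ => coeff_prod_X_eq_ite s _
  rw [← hcoeff, hsum, coeff_linearCombination_X_pow_of_fintype,
    if_pos (by rw [Finsupp.sum_fintype _ _ (by simp), ← ht]; rfl),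
    Finsupp.multinomial_eq_of_support_subset (subset_univ _), Finsupp.prod_fintype _ _ (by simp)]
  simp [hs]

end FiberCounting

section HammingSpace

variable {ι α : Type*} [Fintype ι] [DecidableEq ι] [Fintype α] [DecidableEq α] [Zero α]

theorem natCast_card_filter_ne_zero : (#{a : α | a ≠ 0} : ℝ) = Fintype.card α - 1 := by
  rw [filter_ne', cast_card_erase_of_mem (mem_univ _), card_univ]

theorem card_filter_hammingNorm_eq (i : ℕ) :
    (#{x : ι → α | hammingNorm x = i} : ℝ) =
      (Fintype.card ι).choose i * ((Fintype.card α : ℝ) - 1) ^ i := by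
  rcases lt_or_ge (Fintype.card ι) i with hi | hi
  · rw [Nat.choose_eq_zero_of_lt hi, filter_eq_empty_iff.2
      fun x _ => (hammingNorm_le_card_fintype.trans_lt hi).ne]
    simp
  have hcard : #{x : ι → α | hammingNorm x = i} =
      Nat.multinomial univ (fun b => bif b then i else Fintype.card ι - i) *
        ∏ b, #{a : α | decide (a ≠ 0) = b} ^ bif b then i else Fintype.card ι - i := by
    rw [← card_filter_fiber_card_eq (ι := ι) _ _ (by simp [hi])]
    congr 1
    ext x
    have := card_filter_add_card_filter_not (s := (univ : Finset ι)) (fun j => x j ≠ 0)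
    simp only [card_univ] at this
    simp only [mem_filter, mem_univ, true_and, hammingNorm, Bool.forall_bool,
      decide_eq_true_eq, decide_eq_false_iff_not, cond_true, cond_false]
    omega
  rw [hcard, Nat.cast_mul, natCast_multinomial_univ]
  simp only [Fintype.prod_bool, Fintype.sum_bool, cond_true, cond_false, decide_eq_true_eq,
    decide_eq_false_iff_not, not_not, Nat.cast_mul, Nat.cast_pow, natCast_card_filter_ne_zero]
  simp [filter_eq', Nat.cast_choose ℝ hi, hi]

theorem sphereVolume_eq_card (m : ℕ) :
    sphereVolume (Fintype.card α) (Fintype.card ι) m = #{x : ι → α | hammingNorm x ≤ m} := by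
  rw [sphereVolume, card_eq_sum_card_fiberwise (f := hammingNorm) (t := Icc 0 m)
    (fun x hx => by simpa using hx), Nat.cast_sum]
  refine sum_congr rfl fun i hi => ?_
  rw [← card_filter_hammingNorm_eq, filter_filter]
  congr 2
  ext x
  simp only [mem_filter, mem_univ, true_and, mem_Icc] at hi ⊢
  omega

end HammingSpace

/-- The possible configurations of a pair of letters `(a, b)`: both zero, only the first nonzero,
only the second nonzero, nonzero and equal, nonzero and distinct. -/
inductive LetterPairType
  | zero
  | left
  | right
  | agree
  | differ
  deriving DecidableEq

instance : Fintype LetterPairType where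
  elems := {.zero, .left, .right, .agree, .differ}
  complete c := by cases c <;> simp

theorem LetterPairType.sum_univ {M : Type*} [AddCommMonoid M] (f : LetterPairType → M) :
    ∑ c, f c = f .zero + (f .left + (f .right + (f .agree + f .differ))) := by
  simp [Finset.univ, Fintype.elems]

theorem LetterPairType.prod_univ {M : Type*} [CommMonoid M] (f : LetterPairType → M) :
    ∏ c, f c = f .zero * (f .left * (f .right * (f .agree * f .differ))) := by
  simp [Finset.univ, Fintype.elems]

theorem LetterPairType.forall_iff {p : LetterPairType → Prop} :
    (∀ c, p c) ↔ p .zero ∧ p .left ∧ p .right ∧ p .agree ∧ p .differ :=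
  ⟨fun h => ⟨h _, h _, h _, h _, h _⟩, fun h c => by cases c <;> simp [h]⟩

section LetterPairs

variable {ι α : Type*} [Fintype ι] [DecidableEq α] [Zero α]

/-- The configuration of a pair of letters. -/
def letterPairType (p : α × α) : LetterPairType :=
  if p.1 = 0 then if p.2 = 0 then .zero else .right
  else if p.2 = 0 then .left else if p.1 = p.2 then .agree else .differ

/-- The number of positions at which the pair of words `(x, y)` has configuration `c`. -/
def pairCount (x y : ι → α) (c : LetterPairType) : ℕ := #{i | letterPairType (x i, y i) = c}

theorem hammingNorm_fst_eq_add (x y : ι → α) : hammingNorm x =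
    pairCount x y .left + pairCount x y .agree + pairCount x y .differ := by
  simp only [hammingNorm, pairCount, card_filter, ← sum_add_distrib, letterPairType]
  exact sum_congr rfl fun i _ => by grind

theorem hammingNorm_snd_eq_add (x y : ι → α) : hammingNorm y =
    pairCount x y .right + pairCount x y .agree + pairCount x y .differ := by
  simp only [hammingNorm, pairCount, card_filter, ← sum_add_distrib, letterPairType]
  exact sum_congr rfl fun i _ => by grind

theorem hammingDist_eq_add (x y : ι → α) : hammingDist x y =
    pairCount x y .left + pairCount x y .right + pairCount x y .differ := by
  simp only [hammingDist, pairCount, card_filter, ← sum_add_distrib, letterPairType]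
  exact sum_congr rfl fun i _ => by grind

theorem sum_pairCount (x y : ι → α) : ∑ c, pairCount x y c = Fintype.card ι :=
  (card_eq_sum_card_fiberwise fun _ _ => mem_univ _).symm

theorem mem_Icc_lowerLimit_iff {m : ℕ} (x y : ι → α) :
    pairCount x y .differ ∈
      Icc (lowerLimit (Fintype.card ι) m (hammingNorm x) (hammingNorm y) (pairCount x y .agree))
        (min (hammingNorm x) (hammingNorm y) - pairCount x y .agree) ↔ hammingDist x y ≤ m := by
  have hx := hammingNorm_fst_eq_add x y
  have hy := hammingNorm_snd_eq_add x y
  have hxy := hammingDist_eq_add x y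
  have htotal := sum_pairCount x y
  rw [LetterPairType.sum_univ] at htotal
  rw [mem_Icc, lowerLimit]
  omega

variable [Fintype α]

theorem filter_letterPairType_zero :
    ({p | letterPairType p = .zero} : Finset (α × α)) = ({(0, 0)} : Finset _) := by
  ext ⟨a, b⟩
  grind [letterPairType]

theorem filter_letterPairType_left :
    ({p | letterPairType p = .left} : Finset (α × α)) = ({a | a ≠ 0} : Finset α) ×ˢ {0} := by
  ext ⟨a, b⟩
  grind [letterPairType]

theorem filter_letterPairType_right :
    ({p | letterPairType p = .right} : Finset (α × α)) = {0} ×ˢ ({b | b ≠ 0} : Finset α) := by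
  ext ⟨a, b⟩
  grind [letterPairType]

theorem filter_letterPairType_agree :
    ({p | letterPairType p = .agree} : Finset (α × α)) = diag {a | a ≠ 0} := by
  ext ⟨a, b⟩
  grind [letterPairType]

theorem filter_letterPairType_differ :
    ({p | letterPairType p = .differ} : Finset (α × α)) = offDiag {a | a ≠ 0} := by
  ext ⟨a, b⟩
  grind [letterPairType]

variable [DecidableEq ι]

theorem card_filter_pairCount_eq {w i j k : ℕ} (hw : j + k ≤ w) (hi : j + k ≤ i)
    (hn : w + i ≤ Fintype.card ι + (j + k)) :
    (#{p : (ι → α) × (ι → α) | hammingNorm p.1 = w ∧ hammingNorm p.2 = i ∧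
      pairCount p.1 p.2 .agree = j ∧ pairCount p.1 p.2 .differ = k} : ℝ) =
      edgeTerm (Fintype.card α) (Fintype.card ι) w i j k := by
  set t : LetterPairType → ℕ := fun
    | .zero => Fintype.card ι + (j + k) - w - i
    | .left => w - (j + k)
    | .right => i - (j + k)
    | .agree => j
    | .differ => k with ht
  have hsum : ∑ c, t c = Fintype.card ι := by
    simp only [LetterPairType.sum_univ, ht]
    omega
  have hcard : #{p : (ι → α) × (ι → α) | hammingNorm p.1 = w ∧ hammingNorm p.2 = i ∧
      pairCount p.1 p.2 .agree = j ∧ pairCount p.1 p.2 .differ = k} =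
      #{g : ι → α × α | ∀ c, #{i | letterPairType (g i) = c} = t c} := by
    refine card_equiv (Equiv.arrowProdEquivProdArrow _ _ _).symm fun ⟨x, y⟩ => ?_
    have hx := hammingNorm_fst_eq_add x y
    have hy := hammingNorm_snd_eq_add x y
    have htotal := sum_pairCount x y
    rw [LetterPairType.sum_univ] at htotal
    rw [mem_filter_univ, mem_filter_univ]
    change _ ↔ ∀ c, pairCount x y c = t c
    simp only [LetterPairType.forall_iff, ht]
    omega
  have hdiffer (y : ℝ) : (y - 1) * (y - 1) - (y - 1) = (y - 2) * (y - 1) := by ring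
  have hexp : w + i - (j + k) = (w - (j + k)) + (i - (j + k)) + j + k := by omega
  rw [hcard, card_filter_fiber_card_eq _ _ hsum, Nat.cast_mul, natCast_multinomial_univ, hsum,
    edgeTerm, hexp, Nat.cast_prod]
  simp only [LetterPairType.prod_univ, filter_letterPairType_zero, filter_letterPairType_left,
    filter_letterPairType_right, filter_letterPairType_agree, filter_letterPairType_differ,
    card_singleton, card_product, diag_card, offDiag_card, Nat.cast_pow, Nat.cast_mul,
    Nat.cast_sub (Nat.le_mul_self _), natCast_card_filter_ne_zero, hdiffer, mul_pow, ht]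
  rw [div_mul_eq_mul_div]
  congr 1 <;> ring

theorem card_close_pairs_eq_sum_edgeTerm (m : ℕ) :
    (#{p : (ι → α) × (ι → α) | hammingNorm p.1 ∈ Icc 1 m ∧ hammingNorm p.2 ∈ Icc 1 m ∧
      hammingDist p.1 p.2 ≤ m} : ℝ) =
    ∑ w ∈ Icc 1 m, ∑ i ∈ Icc 1 m, ∑ j ∈ Icc 0 (min w i),
      ∑ k ∈ Icc (lowerLimit (Fintype.card ι) m w i j) (min w i - j),
        edgeTerm (Fintype.card α) (Fintype.card ι) w i j k := by
  rw [card_eq_sum_card_fiberwise (f := fun p => hammingNorm p.1) (t := Icc 1 m)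
    fun p hp => (mem_filter_univ p).1 hp |>.1, Nat.cast_sum]
  refine sum_congr rfl fun w hw => ?_
  rw [card_eq_sum_card_fiberwise (f := fun p => hammingNorm p.2) (t := Icc 1 m) fun p hp => by
    simp_all, Nat.cast_sum]
  refine sum_congr rfl fun i hi => ?_
  rw [card_eq_sum_card_fiberwise (f := fun p => pairCount p.1 p.2 .agree)
    (t := Icc 0 (min w i)) fun p hp => by
      have := hammingNorm_fst_eq_add p.1 p.2
      have := hammingNorm_snd_eq_add p.1 p.2
      simp only [coe_filter, mem_filter, mem_univ, true_and, Set.mem_ofPred_eq] at hp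
      simp only [coe_Icc, Set.mem_Icc]
      omega, Nat.cast_sum]
  refine sum_congr rfl fun j hj => ?_
  rw [card_eq_sum_card_fiberwise (f := fun p => pairCount p.1 p.2 .differ)
    (t := Icc (lowerLimit (Fintype.card ι) m w i j) (min w i - j)) fun p hp => by
      simp only [coe_filter, mem_filter, mem_univ, true_and, Set.mem_ofPred_eq] at hp
      obtain ⟨⟨⟨⟨_, _, h⟩, rfl⟩, rfl⟩, rfl⟩ := hp
      exact mem_coe.2 ((mem_Icc_lowerLimit_iff p.1 p.2).2 h), Nat.cast_sum]
  refine sum_congr rfl fun k hk => ?_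
  have hk' := hk
  simp only [mem_Icc, lowerLimit] at hk' hw hi hj
  rw [← card_filter_pairCount_eq (by omega) (by omega) (by omega)]
  congr 2
  ext p
  simp only [mem_filter, mem_univ, true_and]
  constructor
  · tauto
  · rintro ⟨rfl, rfl, rfl, rfl⟩
    have := (mem_Icc_lowerLimit_iff p.1 p.2).1 hk
    simp only [mem_Icc]
    tauto

end LetterPairs

theorem card_interedges_neighborFinset_iso {V W : Type*} [Fintype V] [Fintype W]
    {G : SimpleGraph V} {H : SimpleGraph W} [DecidableRel G.Adj] [DecidableRel H.Adj]
    (φ : G ≃g H) (v : V) :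
    #(H.interedges (H.neighborFinset (φ v)) (H.neighborFinset (φ v))) =
      #(G.interedges (G.neighborFinset v) (G.neighborFinset v)) := by
  refine (card_equiv (φ.toEquiv.prodCongr φ.toEquiv) fun p => ?_).symm
  simp [SimpleGraph.mem_interedges_iff, φ.map_adj_iff]

section GilbertGraph

variable (ι α : Type*) [Fintype ι] [DecidableEq α]

/-- The Gilbert graph: two distinct words of `ι → α` are adjacent if their Hamming distance is at
most `m`, so that the independent sets are the codes of minimum distance at least `m + 1`. -/
def gilbertGraph (m : ℕ) : SimpleGraph (ι → α) where
  Adj x y := x ≠ y ∧ hammingDist x y ≤ m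
  symm := ⟨fun x y h => ⟨h.1.symm, hammingDist_comm x y ▸ h.2⟩⟩
  loopless := ⟨fun _ h => h.1 rfl⟩

instance (m : ℕ) : DecidableRel (gilbertGraph ι α m).Adj := fun x y =>
  inferInstanceAs (Decidable (x ≠ y ∧ hammingDist x y ≤ m))

variable {ι α}

theorem gilbertGraph_adj {m : ℕ} {x y : ι → α} :
    (gilbertGraph ι α m).Adj x y ↔ x ≠ y ∧ hammingDist x y ≤ m := Iff.rfl

theorem exists_gilbertGraph_iso_apply_eq [AddGroup α] (m : ℕ) (u v : ι → α) :
    ∃ φ : gilbertGraph ι α m ≃g gilbertGraph ι α m, φ u = v := by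
  refine ⟨⟨Equiv.addLeft (v - u), fun {x y} => ?_⟩, sub_add_cancel v u⟩
  have hdist : hammingDist (v - u + x) (v - u + y) = hammingDist x y :=
    hammingDist_comp (fun i => ((v - u) i + ·)) fun i => add_right_injective _
  simp [gilbertGraph_adj, hdist]

variable [DecidableEq ι] [Fintype α]

section Zero

variable [Zero α]

theorem mem_neighborFinset_gilbertGraph_zero {m : ℕ} {x : ι → α} :
    x ∈ (gilbertGraph ι α m).neighborFinset 0 ↔ hammingNorm x ∈ Icc 1 m := by
  rw [SimpleGraph.mem_neighborFinset, gilbertGraph_adj, hammingDist_zero_left, mem_Icc,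
    Nat.one_le_iff_ne_zero, hammingNorm_ne_zero_iff, ne_comm]

theorem degree_gilbertGraph_zero_add_one (m : ℕ) :
    ((gilbertGraph ι α m).degree 0 : ℝ) + 1 =
      sphereVolume (Fintype.card α) (Fintype.card ι) m := by
  have hball : ({x : ι → α | hammingNorm x ≤ m} : Finset _) =
      insert 0 ((gilbertGraph ι α m).neighborFinset 0) := by
    ext x
    rw [mem_insert, mem_neighborFinset_gilbertGraph_zero, ← hammingNorm_eq_zero, mem_Icc,
      mem_filter_univ]
    omega
  rw [sphereVolume_eq_card, hball, card_insert_of_notMem (by simp),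
    SimpleGraph.card_neighborFinset_eq_degree, Nat.cast_add_one]

theorem card_interedges_gilbertGraph_zero (m : ℕ) :
    (#((gilbertGraph ι α m).interedges ((gilbertGraph ι α m).neighborFinset 0)
      ((gilbertGraph ι α m).neighborFinset 0)) : ℝ) =
      6 * edgeQuantity (Fintype.card α) (Fintype.card ι) m + 1 := by
  set N := (gilbertGraph ι α m).neighborFinset 0 with hN
  have hclose : ({p : (ι → α) × (ι → α) | hammingNorm p.1 ∈ Icc 1 m ∧ hammingNorm p.2 ∈ Icc 1 m ∧
      hammingDist p.1 p.2 ≤ m} : Finset _) = (gilbertGraph ι α m).interedges N N ∪ N.diag := by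
    ext ⟨x, y⟩
    rw [mem_filter_univ, ← mem_neighborFinset_gilbertGraph_zero,
      ← mem_neighborFinset_gilbertGraph_zero, mem_union, SimpleGraph.mem_interedges_iff, mem_diag,
      gilbertGraph_adj, ← hN]
    grind [hammingDist_self]
  have hdisj : Disjoint ((gilbertGraph ι α m).interedges N N) N.diag := by
    rw [disjoint_left]
    rintro ⟨x, y⟩ hadj heq
    exact (SimpleGraph.mem_interedges_iff _ |>.1 hadj).2.2.ne (mem_diag.1 heq).2
  have hcount := card_close_pairs_eq_sum_edgeTerm (ι := ι) (α := α) m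
  rw [hclose, card_union_of_disjoint hdisj, diag_card, hN,
    SimpleGraph.card_neighborFinset_eq_degree, ← hN] at hcount
  push_cast at hcount
  rw [edgeQuantity, ← hcount, ← degree_gilbertGraph_zero_add_one]
  ring

end Zero

variable [AddGroup α]

theorem degree_gilbertGraph_add_one (m : ℕ) (v : ι → α) :
    ((gilbertGraph ι α m).degree v : ℝ) + 1 =
      sphereVolume (Fintype.card α) (Fintype.card ι) m := by
  obtain ⟨φ, rfl⟩ := exists_gilbertGraph_iso_apply_eq m 0 v
  rw [φ.degree_eq, degree_gilbertGraph_zero_add_one]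

theorem card_interedges_gilbertGraph (m : ℕ) (v : ι → α) :
    (#((gilbertGraph ι α m).interedges ((gilbertGraph ι α m).neighborFinset v)
      ((gilbertGraph ι α m).neighborFinset v)) : ℝ) =
      6 * edgeQuantity (Fintype.card α) (Fintype.card ι) m + 1 := by
  obtain ⟨φ, rfl⟩ := exists_gilbertGraph_iso_apply_eq m 0 v
  rw [card_interedges_neighborFinset_iso φ, card_interedges_gilbertGraph_zero]

end GilbertGraph

section GilbertGraphIndependence

variable {ι α : Type*} [Fintype ι] [Fintype α]

/-- `6 * edgeQuantity + 1` counts ordered adjacent pairs, so `6 * edgeQuantity` is an integer. -/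
theorem one_le_six_mul_edgeQuantity [Zero α] {m : ℕ}
    (he : 0 < edgeQuantity (Fintype.card α) (Fintype.card ι) m) :
    1 ≤ 6 * edgeQuantity (Fintype.card α) (Fintype.card ι) m := by
  classical
  have hpairs := card_interedges_gilbertGraph_zero (ι := ι) (α := α) m
  have hgt : (1 : ℝ) < #((gilbertGraph ι α m).interedges ((gilbertGraph ι α m).neighborFinset 0)
      ((gilbertGraph ι α m).neighborFinset 0)) := by linarith
  have hge : (1 : ℝ) + 1 ≤ #((gilbertGraph ι α m).interedges
      ((gilbertGraph ι α m).neighborFinset 0) ((gilbertGraph ι α m).neighborFinset 0)) := by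
    exact_mod_cast hgt
  linarith

theorem mul_logb_le_indepNum_gilbertGraph [DecidableEq α] [AddGroup α] {m : ℕ}
    (he : 0 < edgeQuantity (Fintype.card α) (Fintype.card ι) m) :
    (Fintype.card α : ℝ) ^ Fintype.card ι / sphereVolume (Fintype.card α) (Fintype.card ι) m *
        ((Real.logb 2 (sphereVolume (Fintype.card α) (Fintype.card ι) m) -
          Real.logb 2 √(edgeQuantity (Fintype.card α) (Fintype.card ι) m)) / 10) ≤
      (gilbertGraph ι α m).indepNum := by
  classical
  set E := edgeQuantity (Fintype.card α) (Fintype.card ι) m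
  set S := sphereVolume (Fintype.card α) (Fintype.card ι) m
  have hE6 : 1 ≤ 6 * E := one_le_six_mul_edgeQuantity he
  have hdeg (v) : ((gilbertGraph ι α m).degree v : ℝ) + 1 = S := degree_gilbertGraph_add_one m v
  have hS_pos : 0 < S := hdeg 0 ▸ by positivity
  have hbound := card_mul_logb_le_indepNum (G := gilbertGraph ι α m) (p := 6 * E + 1)
    (fun v => Nat.cast_le (α := ℝ).1 (by linarith [hdeg 0, hdeg v])) (by linarith)
    (fun v => (card_interedges_gilbertGraph m v).le)
  rw [hdeg 0, Fintype.card_fun, Nat.cast_pow] at hbound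
  refine le_trans ?_ hbound
  rw [← Real.logb_div hS_pos.ne' (by positivity)]
  gcongr
  · exact one_lt_two
  · linarith

end GilbertGraphIndependence

section Codes

variable {q n d : ℕ}

theorem IsCode.card_le_maxCodeSize {C : Finset (Fin n → Fin q)} (hC : IsCode q n d C) :
    #C ≤ maxCodeSize q n d := by
  classical
  exact le_sup (f := Finset.card) (mem_filter.2 ⟨mem_univ _, hC⟩)

theorem isCode_of_isIndepSet_gilbertGraph {C : Finset (Fin n → Fin q)}
    (hC : (gilbertGraph (Fin n) (Fin q) (d - 1)).IsIndepSet C) : IsCode q n d C := by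
  intro u hu v hv huv
  have hfar : ¬(u ≠ v ∧ hammingDist u v ≤ d - 1) := hC hu hv huv
  have hpos := hammingDist_pos.2 huv
  grind

theorem indepNum_gilbertGraph_le_maxCodeSize :
    (gilbertGraph (Fin n) (Fin q) (d - 1)).indepNum ≤ maxCodeSize q n d := by
  obtain ⟨C, hC⟩ := (gilbertGraph (Fin n) (Fin q) (d - 1)).exists_isNIndepSet_indepNum
  exact hC.card_eq ▸ (isCode_of_isIndepSet_gilbertGraph hC.isIndepSet).card_le_maxCodeSize

end Codes

theorem mainTheorem6 (q n d : ℕ) (hq : 2 ≤ q) (hd : 1 ≤ d) (hdn : d ≤ n)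
    (he : 0 < edgeQuantity q n (d - 1)) :
    (maxCodeSize q n d : ℝ) ≥
      ((q : ℝ) ^ n / sphereVolume q n (d - 1)) *
        ((Real.logb 2 (sphereVolume q n (d - 1)) -
          Real.logb 2 (Real.sqrt (edgeQuantity q n (d - 1)))) / 10) := by
  have : NeZero q := ⟨by omega⟩
  have hcode : ((gilbertGraph (Fin n) (Fin q) (d - 1)).indepNum : ℝ) ≤ maxCodeSize q n d :=
    mod_cast indepNum_gilbertGraph_le_maxCodeSize
  have hgraph := mul_logb_le_indepNum_gilbertGraph (ι := Fin n) (α := Fin q) (m := d - 1)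
  simp only [Fintype.card_fin] at hgraph
  exact (hgraph he).trans hcode
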